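/- Let $S$ be a finite set of states and, for each $s\in S$, let $A_s$ be a finite nonempty set of actions; let $0\le\gamma<1$, and write $\Delta(s)$ for the set of probability vectors on $A_s$. The uncertain parameters of a state $s$ are transition probabilities $\mathbf p_s=(p(\cdot\mid s,a))_{a\in A_s}$ (each $p(\cdot\mid s,a)$ a probability vector on $S$) and rewards $\mathbf r_s=(r(s,a))_{a\in A_s}\in\mathbb R^{A_s}$; $\tilde{\mathbf u}_s\in\mathbb R^{Q_s}$ is an auxiliary random vector. For each $s$ let $$\tilde{\mathcal C}_s=\Big\{\mu_s \text{ a law of } (\mathbf p_s,\mathbf r_s,\tilde{\mathbf u}_s)\ \Big|\ \mathbb E_{\mu_s}[F_s\mathbf p_s+G_s\mathbf r_s+H_s\tilde{\mathbf u}_s]=\mathbf c_s,\ \ \mu_s(O_s^i)\in[\underline\alpha_s^i,\overline\alpha_s^i]\ (1\le i\le n_s)\Big\},$$ where $0\le\underline\alpha_s^i\le\overline\alpha_s^i\le1$ and each confidence set is nonempty and of the form $O_s^i=\{(\mathbf p,\mathbf r,\mathbf u)\mid \mathbf b_s^i-(B_s^i\mathbf p+D_s^i\mathbf r+E_s^i\mathbf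 u)\in K_s^i\}$ with a proper (closed, convex, pointed, with nonempty interior) cone $K_s^i$. Suppose that, for every $s$, some confidence set $O_s^i$ is bounded and has $\underline\alpha_s^i=\overline\alpha_s^i=1$. Let $\mathcal C_s$ be the set of the marginal laws of $(\mathbf p_s,\mathbf r_s)$ under the laws in $\tilde{\mathcal C}_s$. In the non-stationary model the pair $(s,t)$, state $s$ at epoch $t=1,2,\dots$, has its own parameters $(\mathbf p_{s,t},\mathbf r_{s,t})$, and the ambiguity set is $$\overline{\mathcal C}^\infty_S=\Big\{\bigotimes_{s\in S,\,t\ge1}\mu_{s,t}\ \Big|\ \mu_{s,t}\in\mathcal C_s \text{ for all } s,t\Big\}.$$ For a history-dependent randomized strategy $\pi$ (which observes past states and actions and the current state), an initial state $s_1$ and $\mu\in\overline{\mathcal C}^\infty_S$, put $w(\pi,\mu,s_1)=\mathbb E_{(\mathbf p,\mathbf r)\sim\mu}\,\mathbb E_\pi^{(\mathbf p,\mathbf r)}\big[\sum_{t\ge1}\gamma^{t-1}r_{s_t,t}(s_t,a_t)\big]$, where the inner expectation is over the trajectory started at $s_1$ in which, at epoch $t$, the transition probabilities $\mathbf p_{s_t,t}$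 are used. A function $v:S\to\mathbb R$ is an S-robust value if for every $s\in S$ $$v(s)=\max_{d\in\Delta(s)}\ \inf_{\mu_s\in\mathcal C_s}\ \mathbb E_{(\mathbf p_s,\mathbf r_s)\sim\mu_s}\Big[\sum_{a\in A_s}d(a)\Big(r(s,a)+\gamma\sum_{s'\in S}p(s'\mid s,a)v(s')\Big)\Big],$$ and $d\in\Delta(s)$ is an S-robust action of $s$ if it attains this maximum. A strategy $\pi^*$ is S-robust if, for some S-robust value $v$, after every history that ends at a state $s$ it takes an S-robust action of $s$. Theorem. Every S-robust strategy $\pi^*$ is distributionally robust with respect to $\overline{\mathcal C}^\infty_S$: for every initial state $s_1$ and every history-dependent randomized strategy $\pi$, $$\inf_{\mu\in\overline{\mathcal C}^\infty_S}w(\pi,\mu,s_1)\ \le\ \inf_{\mu\in\overline{\mathcal C}^\infty_S}w(\pi^*,\mu,s_1).$$ -/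

import Mathlib

open MeasureTheory ProbabilityTheory

namespace DAMDP

/-! ### Parameters of a state -/

/-- Uncertain parameters `(p_s, r_s)` of the state `s`: for every action a probability vector of
the next state, and for every action a reward. -/
abbrev Param {S : Type*} [Fintype S] (A : S → Type*) (s : S) :=
  (A s → stdSimplex ℝ S) × (A s → ℝ)

/-- Lifted parameters `(p_s, r_s, u_s)`, with an auxiliary vector `u_s ∈ ℝ^Q`. -/
abbrev LiftedParam {S : Type*} [Fintype S] (A : S → Type*) (s : S) (Q : ℕ) :=
  (A s → stdSimplex ℝ S) × (A s → ℝ) × (Fin Q → ℝ)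

/-- The vector `p_s ∈ ℝ^(A_s × S)`. -/
def pVec {S : Type*} [Fintype S] {A : S → Type*} {s : S} (p : A s → stdSimplex ℝ S) :
    A s × S → ℝ :=
  fun x => p x.1 x.2

/-- The position of lifted parameters in `ℝ^(A_s × S) × ℝ^(A_s) × ℝ^Q`. -/
def liftedVec {S : Type*} [Fintype S] {A : S → Type*} {s : S} {Q : ℕ} (θ : LiftedParam A s Q) :
    (A s × S → ℝ) × (A s → ℝ) × (Fin Q → ℝ) :=
  (pVec θ.1, θ.2.1, θ.2.2)

/-! ### State-wise ambiguity sets -/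

/-- The data of a state-wise ambiguity set in standard form, at the state `s`: the mean constraint
`E[F p + G r + H u] = c`, and finitely many confidence sets
`{(p, r, u) | B i p + D i r + E i u ⪯_{K i} b i}`, the `i`-th with bounds `lo i ≤ hi i` in
`[0, 1]` on its probability. -/
structure AmbiguityData {S : Type*} (A : S → Type*) (s : S) where
  /-- number of rows of the mean constraint -/
  k : ℕ
  /-- dimension of the auxiliary vector -/
  Q : ℕ
  F : Matrix (Fin k) (A s × S) ℝ
  G : Matrix (Fin k) (A s) ℝ
  H : Matrix (Fin k) (Fin Q) ℝ
  c : Fin k → ℝ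
  /-- number of confidence sets -/
  n : ℕ
  /-- number of rows of the constraint that describes a confidence set -/
  L : Fin n → ℕ
  B : ∀ i, Matrix (Fin (L i)) (A s × S) ℝ
  D : ∀ i, Matrix (Fin (L i)) (A s) ℝ
  E : ∀ i, Matrix (Fin (L i)) (Fin Q) ℝ
  b : ∀ i, Fin (L i) → ℝ
  /-- a closed convex cone that contains `0` -/
  K : ∀ i, ProperCone ℝ (Fin (L i) → ℝ)
  lo : Fin n → ℝ
  hi : Fin n → ℝ
  lo_nonneg : ∀ i, 0 ≤ lo i
  lo_le_hi : ∀ i, lo i ≤ hi i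
  hi_le_one : ∀ i, hi i ≤ 1

namespace AmbiguityData

variable {S : Type*} [Fintype S] {A : S → Type*} {s : S} [Fintype (A s)]

/-- The `i`-th confidence set; `x ⪯_K y` means `y - x ∈ K`. -/
def confidenceSet (X : AmbiguityData A s) (i : Fin X.n) :
    Set ((A s × S → ℝ) × (A s → ℝ) × (Fin X.Q → ℝ)) :=
  {x | X.b i - ((X.B i).mulVec x.1 + (X.D i).mulVec x.2.1 + (X.E i).mulVec x.2.2) ∈ X.K i}

/-- The requirements on the confidence sets: each is nonempty, and each cone `K i` is pointed
(contains no line) and has nonempty interior. Closedness and convexity of `K i` are part of its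
type, and convexity of the confidence sets follows from their form. -/
def ConicRepresentable (X : AmbiguityData A s) : Prop :=
  ∀ i, (X.confidenceSet i).Nonempty ∧ (∀ y, y ∈ X.K i → -y ∈ X.K i → y = 0) ∧
    (interior (X.K i : Set (Fin (X.L i) → ℝ))).Nonempty

/-- Some confidence set is bounded and has probability one. -/
def BoundedSupport (X : AmbiguityData A s) : Prop :=
  ∃ i, Bornology.IsBounded (X.confidenceSet i) ∧ X.lo i = 1 ∧ X.hi i = 1

/-- The value `F p + G r + H u`. -/
def meanMap (X : AmbiguityData A s) (θ : LiftedParam A s X.Q) : Fin X.k → ℝ :=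
  X.F.mulVec (pVec θ.1) + X.G.mulVec θ.2.1 + X.H.mulVec θ.2.2

/-- The state-wise ambiguity set: the joint laws of `(p_s, r_s, u_s)` that satisfy the mean
constraint and the probability bounds. -/
def lifted (X : AmbiguityData A s) : Set (ProbabilityMeasure (LiftedParam A s X.Q)) :=
  {μ | Integrable X.meanMap (μ : Measure (LiftedParam A s X.Q)) ∧
    ∫ θ, X.meanMap θ ∂(μ : Measure (LiftedParam A s X.Q)) = X.c ∧
    ∀ i, (μ : Measure (LiftedParam A s X.Q)).real (liftedVec ⁻¹' X.confidenceSet i) ∈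
      Set.Icc (X.lo i) (X.hi i)}

/-- The set of the marginal laws of `(p_s, r_s)`. -/
def marginal (X : AmbiguityData A s) : Set (ProbabilityMeasure (Param A s)) :=
  {ν | ∃ μ ∈ X.lifted, (ν : Measure (Param A s)) =
    (μ : Measure (LiftedParam A s X.Q)).map (fun θ => (θ.1, θ.2.1))}

end AmbiguityData

/-! ### The non-stationary ambiguity set -/

/-- A realization of the parameters of all augmented states `(s, t)`; `t = 0` is the first
decision epoch. -/
abbrev ParamPath {S : Type*} [Fintype S] (A : S → Type*) := (x : S × ℕ) → Param A x.1

/-- The non-stationary ambiguity set: the products, over all augmented states `(s, t)`, of laws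
`ν (s, t) ∈ C s`. -/
def nonstationarySet {S : Type*} [Fintype S] {A : S → Type*}
    (C : ∀ s, Set (ProbabilityMeasure (Param A s))) : Set (Measure (ParamPath A)) :=
  {μ | ∃ ν : (x : S × ℕ) → ProbabilityMeasure (Param A x.1), (∀ x, ν x ∈ C x.1) ∧
    μ = Measure.infinitePi (fun x => (ν x : Measure (Param A x.1)))}

/-! ### Strategies and their performance -/

/-- State-action pairs, with the discrete σ-algebra. -/
structure StateAction {S : Type*} (A : S → Type*) where
  state : S
  action : A state

instance {S : Type*} (A : S → Type*) : MeasurableSpace (StateAction A) := ⊤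

instance {S : Type*} (A : S → Type*) : DiscreteMeasurableSpace (StateAction A) :=
  ⟨fun _ => trivial⟩

instance {S : Type*} [Finite S] (A : S → Type*) [∀ s, Finite (A s)] : Finite (StateAction A) :=
  Finite.of_injective (fun x : StateAction A => (⟨x.state, x.action⟩ : Σ s, A s)) (by
    rintro ⟨s, a⟩ ⟨s', a'⟩ h
    cases h
    rfl)

/-- History-dependent randomized strategies: at epoch `n`, given the past state-action pairs and
the current state `s`, a probability vector on the actions of `s`. -/
abbrev Strategy {S : Type*} (A : S → Type*) [∀ s, Fintype (A s)] :=
  (n : ℕ) → (Fin n → StateAction A) → (s : S) → stdSimplex ℝ (A s)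

section Performance

variable {S : Type*} [Fintype S] {A : S → Type*} [∀ s, Fintype (A s)]

/-- The law of `(s, a)` when `a` has the law `d`. -/
noncomputable def actionMeasure (s : S) (d : stdSimplex ℝ (A s)) : Measure (StateAction A) :=
  ∑ a, ENNReal.ofReal (d a) • Measure.dirac (α := StateAction A) ⟨s, a⟩

instance (s : S) (d : stdSimplex ℝ (A s)) : IsProbabilityMeasure (actionMeasure s d) := by
  constructor
  have h : ∑ a, ENNReal.ofReal (d a) = 1 := by
    have h' : ∑ a, d a = 1 := d.2.2
    rw [← ENNReal.ofReal_sum_of_nonneg (fun a _ => show 0 ≤ d a from d.2.1 a), h',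
      ENNReal.ofReal_one]
  simpa [actionMeasure] using h

/-- The law of the next pair `(s', a')` when `s'` has the law `q` and, given `s'`, `a'` has the
law `d s'`. -/
noncomputable def stepMeasure (q : stdSimplex ℝ S) (d : (s : S) → stdSimplex ℝ (A s)) :
    Measure (StateAction A) :=
  ∑ s, ENNReal.ofReal (q s) • actionMeasure s (d s)

instance (q : stdSimplex ℝ S) (d : (s : S) → stdSimplex ℝ (A s)) :
    IsProbabilityMeasure (stepMeasure q d) := by
  constructor
  have h : ∑ s, ENNReal.ofReal (q s) = 1 := by
    have h' : ∑ s, q s = 1 := q.2.2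
    rw [← ENNReal.ofReal_sum_of_nonneg (fun s _ => show 0 ≤ q s from q.2.1 s), h',
      ENNReal.ofReal_one]
  simpa [stepMeasure] using h

/-- The transition from the pairs at the epochs `0, …, n` to the pair at the epoch `n + 1`, under
the strategy `π` and the parameters `θ`: the next state is drawn from the transition vector of
the augmented state `(s_n, n)` and the action `a_n`. -/
noncomputable def stepKernel (π : Strategy A) (θ : ParamPath A) (n : ℕ) :
    Kernel ((i : Finset.Iic n) → StateAction A) (StateAction A) :=
  Kernel.ofFunOfCountable fun x =>
    stepMeasure
      ((θ ((x ⟨n, Finset.mem_Iic.2 le_rfl⟩).state, n)).1 (x ⟨n, Finset.mem_Iic.2 le_rfl⟩).action)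
      (π (n + 1) (fun i => x ⟨i, Finset.mem_Iic.2 (Nat.lt_succ_iff.1 i.2)⟩))

instance (π : Strategy A) (θ : ParamPath A) (n : ℕ) : IsMarkovKernel (stepKernel π θ n) :=
  ⟨fun x => by
    change IsProbabilityMeasure (stepMeasure _ _)
    infer_instance⟩

/-- The law of the sequence of state-action pairs under the strategy `π` and the parameters `θ`,
started in the state `s₀`. -/
noncomputable def pathMeasure (π : Strategy A) (θ : ParamPath A) (s₀ : S) :
    Measure (ℕ → StateAction A) :=
  Kernel.trajMeasure (X := fun _ => StateAction A)
    (actionMeasure s₀ (π 0 Fin.elim0 s₀)) (stepKernel π θ)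

/-- The total discounted reward along a sequence of state-action pairs. -/
noncomputable def totalReward (γ : ℝ) (θ : ParamPath A) (x : ℕ → StateAction A) : ℝ :=
  ∑' t, γ ^ t * (θ ((x t).state, t)).2 (x t).action

/-- The expected total discounted reward under fixed parameters. -/
noncomputable def u (γ : ℝ) (π : Strategy A) (θ : ParamPath A) (s₀ : S) : ℝ :=
  ∫ x, totalReward γ θ x ∂(pathMeasure π θ s₀)

/-- The expected performance when the parameters have the law `μ`. -/
noncomputable def w (γ : ℝ) (π : Strategy A) (μ : Measure (ParamPath A)) (s₀ : S) : ℝ :=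
  ∫ θ, u γ π θ s₀ ∂μ

/-- `π` is distributionally robust with respect to the set `C` of laws of the parameters, for the
initial state `s₀`: it maximizes the worst-case expected performance. The infima are taken in
the extended reals. -/
def IsDistributionallyRobust (γ : ℝ) (C : Set (Measure (ParamPath A))) (π : Strategy A)
    (s₀ : S) : Prop :=
  ∀ π' : Strategy A,
    ⨅ μ ∈ C, (w γ π' μ s₀ : EReal) ≤ ⨅ μ ∈ C, (w γ π μ s₀ : EReal)

/-! ### S-robust strategies -/

/-- The expectation of `r(s, a) + γ v(s')` under parameters `θ` of `s` and a randomized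
action `d`. -/
noncomputable def oneStep (γ : ℝ) (v : S → ℝ) (s : S) (d : stdSimplex ℝ (A s))
    (θ : Param A s) : ℝ :=
  ∑ a, d a * (θ.2 a + γ * ∑ s', θ.1 a s' * v s')

/-- The worst-case expectation, over the laws in `C`, of the one-step value. -/
noncomputable def worstCase (γ : ℝ) (v : S → ℝ) (s : S) (C : Set (ProbabilityMeasure (Param A s)))
    (d : stdSimplex ℝ (A s)) : EReal :=
  ⨅ μ ∈ C, ((∫ θ, oneStep γ v s d θ ∂(μ : Measure (Param A s)) : ℝ) : EReal)

/-- `v` is an S-robust value: `v s` is, for every `s`, the maximum over the randomized actions of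
the worst-case one-step value with continuation value `v`. -/
def IsSRobustValue (γ : ℝ) (C : ∀ s, Set (ProbabilityMeasure (Param A s))) (v : S → ℝ) : Prop :=
  ∀ s, IsGreatest (Set.range (worstCase γ v s (C s))) (v s : EReal)

/-- `d` is a randomized action that maximizes the worst-case one-step value with continuation
value `v`. -/
def IsSRobustAction (γ : ℝ) (C : ∀ s, Set (ProbabilityMeasure (Param A s))) (v : S → ℝ) (s : S)
    (d : stdSimplex ℝ (A s)) : Prop :=
  ∀ d' : stdSimplex ℝ (A s), worstCase γ v s (C s) d' ≤ worstCase γ v s (C s) d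

/-- `π` is an S-robust strategy: after every history, it takes an S-robust action of the current
state. (A stationary strategy is the case in which `π` ignores the epoch and the past.) -/
def IsSRobustStrategy (γ : ℝ) (C : ∀ s, Set (ProbabilityMeasure (Param A s))) (π : Strategy A) :
    Prop :=
  ∃ v : S → ℝ, IsSRobustValue γ C v ∧ ∀ n h s, IsSRobustAction γ C v s (π n h s)

end Performance

end DAMDP

/-! Let `v` be the S-robust value belonging to `π`. Both sides of the claim are compared with `v
s₀`: under every product law `π` earns at least `v s₀`, and against every strategy some product law
keeps the gain arbitrarily close to `v s₀`.

For fixed parameters, the Bellman expression telescopes along the trajectory (`sum_reward_eq`), so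
the performance is `v s₀` plus the discounted sum of expected advantages. The history up to the
state at epoch `n + 1` involves only parameters of epochs at most `n`, hence is independent of the
parameters of `(s, n + 1)`. Consequently the expected advantage at an epoch is an average of
quantities `E[oneStep] - v s` under the single laws `ν (s, n)` (`integral_expected_advantage_mem`),
and one-step inequalities pass to the total reward (`le_performance`, `performance_le`).

For `π` the one-step inequality is the definition of an S-robust action. For the converse, nature
needs one law per state that is nearly worst for all randomized actions at once. A minimax argument
provides it (`exists_law_forall_oneStep_le`), since the set of laws at a state is closed under
mixtures and the action simplex is finite-dimensional. Using that law at every epoch defeats any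
history-dependent strategy. -/

namespace DAMDP

section Measurability

variable {S : Type*} [Fintype S] {A : S → Type*}

lemma measurable_transition (s s' : S) (a : A s) (n : ℕ) :
    Measurable fun θ : ParamPath A => (θ (s, n)).1 a s' := by
  have h : Measurable fun q : stdSimplex ℝ S => q s' :=
    (measurable_pi_apply s').comp measurable_subtype_coe
  have h2 : Measurable fun θ : ParamPath A => θ (s, n) := measurable_pi_apply (s, n)
  exact h.comp ((measurable_pi_apply a).comp (measurable_fst.comp h2))

end Measurability

/-! ### Law of the trajectory and probabilities of histories. -/

section Path

variable {S : Type*} [Fintype S] {A : S → Type*} [∀ s, Fintype (A s)]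

lemma integral_actionMeasure (s : S) (d : stdSimplex ℝ (A s)) (f : StateAction A → ℝ) :
    ∫ y, f y ∂(actionMeasure s d) = ∑ a, d a * f ⟨s, a⟩ := by
  rw [actionMeasure, integral_finsetSum_measure]
  · refine Finset.sum_congr rfl fun a _ => ?_
    rw [integral_smul_measure, integral_dirac, ENNReal.toReal_ofReal (show 0 ≤ d a from d.2.1 a),
      smul_eq_mul]
  · intro a _
    exact (integrable_dirac (by simp)).smul_measure ENNReal.ofReal_ne_top

lemma integral_stepMeasure (q : stdSimplex ℝ S) (d : (s : S) → stdSimplex ℝ (A s))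
    (f : StateAction A → ℝ) :
    ∫ y, f y ∂(stepMeasure q d) = ∑ s, q s * ∑ a, d s a * f ⟨s, a⟩ := by
  rw [stepMeasure, integral_finsetSum_measure]
  · refine Finset.sum_congr rfl fun s _ => ?_
    rw [integral_smul_measure, integral_actionMeasure, 
      ENNReal.toReal_ofReal (show 0 ≤ q s from q.2.1 s), smul_eq_mul]
  · intro a _
    exact Integrable.of_finite.smul_measure ENNReal.ofReal_ne_top

instance (π : Strategy A) (θ : ParamPath A) (s₀ : S) :
    IsProbabilityMeasure (pathMeasure π θ s₀) := by
  unfold pathMeasure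
  infer_instance

/-- The last state-action pair of a history. -/
def lastPair {n : ℕ} (h : (i : Finset.Iic n) → StateAction A) : StateAction A :=
  h ⟨n, Finset.mem_Iic.2 le_rfl⟩

/-- A history, as a tuple indexed by `Fin`. -/
def toFin {n : ℕ} (h : (i : Finset.Iic n) → StateAction A) : Fin (n + 1) → StateAction A :=
  fun i => h ⟨i, Finset.mem_Iic.2 (Nat.lt_succ_iff.1 i.2)⟩

/-- There are finitely many histories of a given length, so no bound on the rewards is needed while
`θ` is fixed. -/
lemma integrable_frestrictLe (π : Strategy A) (θ : ParamPath A) (s₀ : S) (n : ℕ)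
    (f : ((i : Finset.Iic n) → StateAction A) → ℝ) :
    Integrable (fun x => f (Preorder.frestrictLe n x)) (pathMeasure π θ s₀) :=
  (Integrable.of_finite (μ := (pathMeasure π θ s₀).map
    (Preorder.frestrictLe (π := fun _ => StateAction A) n))).comp_measurable (by fun_prop)

lemma integrable_eval (π : Strategy A) (θ : ParamPath A) (s₀ : S) (n : ℕ)
    (f : StateAction A → ℝ) :
    Integrable (fun x => f (x n)) (pathMeasure π θ s₀) :=
  integrable_frestrictLe π θ s₀ n fun h => f (lastPair h)

lemma integral_eval_zero (π : Strategy A) (θ : ParamPath A) (s₀ : S) (f : StateAction A → ℝ) :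
    ∫ x, f (x 0) ∂(pathMeasure π θ s₀) = ∑ a, π 0 Fin.elim0 s₀ a * f ⟨s₀, a⟩ := by
  rw [← integral_actionMeasure]
  have h1 : ∫ x, f (x 0) ∂(pathMeasure π θ s₀) =
      ∫ h, f (lastPair h) ∂((pathMeasure π θ s₀).map
        (Preorder.frestrictLe (π := fun _ => StateAction A) 0)) := by
    rw [integral_map (by fun_prop) (Measurable.of_discrete).aestronglyMeasurable]
    rfl
  rw [h1, pathMeasure, Kernel.trajMeasure, Measure.map_comp _ _ (by fun_prop),
    Kernel.traj_map_frestrictLe, Kernel.partialTraj_self, Measure.id_comp,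
    integral_map (by fun_prop) (Measurable.of_discrete).aestronglyMeasurable]
  rfl

/-- Disintegration of the joint law of the history and the next pair. The whole history must be kept
as an argument because the next action may depend on all of it. -/
lemma integral_succ (π : Strategy A) (θ : ParamPath A) (s₀ : S) (n : ℕ)
    (f : ((i : Finset.Iic n) → StateAction A) → StateAction A → ℝ) :
    ∫ x, f (Preorder.frestrictLe n x) (x (n + 1)) ∂(pathMeasure π θ s₀) =
      ∫ x, ∑ s, (θ ((x n).state, n)).1 (x n).action s *
        ∑ a, π (n + 1) (toFin (Preorder.frestrictLe n x)) s a *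
          f (Preorder.frestrictLe n x) ⟨s, a⟩ ∂(pathMeasure π θ s₀) := by
  have h1 : ∫ x, f (Preorder.frestrictLe n x) (x (n + 1)) ∂(pathMeasure π θ s₀) =
      ∫ y, f y.1 y.2 ∂((pathMeasure π θ s₀).map
        (fun x => (Preorder.frestrictLe n x, x (n + 1)))) := by
    rw [integral_map (by fun_prop) (Measurable.of_discrete).aestronglyMeasurable]
  rw [h1, pathMeasure, ← Kernel.map_frestrictLe_trajMeasure_compProd_eq_map_trajMeasure,
    Measure.integral_compProd Integrable.of_finite,
    integral_map (by fun_prop) (Measurable.of_discrete).aestronglyMeasurable]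
  refine integral_congr_ae (ae_of_all _ fun x => ?_)
  exact integral_stepMeasure _ _ _

/-- The probability of a history. -/
noncomputable def histProb (π : Strategy A) (s₀ : S) (n : ℕ)
    (h : (i : Finset.Iic n) → StateAction A) (θ : ParamPath A) : ℝ :=
  (pathMeasure π θ s₀).real (Preorder.frestrictLe n ⁻¹' {h})

lemma histProb_nonneg (π : Strategy A) (s₀ : S) (n : ℕ)
    (h : (i : Finset.Iic n) → StateAction A) (θ : ParamPath A) : 0 ≤ histProb π s₀ n h θ :=
  measureReal_nonneg

lemma histProb_le_one (π : Strategy A) (s₀ : S) (n : ℕ)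
    (h : (i : Finset.Iic n) → StateAction A) (θ : ParamPath A) : histProb π s₀ n h θ ≤ 1 :=
  measureReal_le_one

noncomputable instance (n : ℕ) : Fintype ((i : Finset.Iic n) → StateAction A) :=
  Fintype.ofFinite _

lemma integral_frestrictLe (π : Strategy A) (θ : ParamPath A) (s₀ : S) (n : ℕ)
    (f : ((i : Finset.Iic n) → StateAction A) → ℝ) :
    ∫ x, f (Preorder.frestrictLe n x) ∂(pathMeasure π θ s₀) =
      ∑ h, histProb π s₀ n h θ * f h := by
  rw [← integral_map (φ := Preorder.frestrictLe (π := fun _ => StateAction A) n) (by fun_prop)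
    (Measurable.of_discrete).aestronglyMeasurable, integral_fintype Integrable.of_finite]
  refine Finset.sum_congr rfl fun h _ => ?_
  rw [map_measureReal_apply (by fun_prop) (measurableSet_singleton h), smul_eq_mul]
  rfl

lemma sum_histProb (π : Strategy A) (θ : ParamPath A) (s₀ : S) (n : ℕ) :
    ∑ h, histProb π s₀ n h θ = 1 := by
  have := integral_frestrictLe π θ s₀ n fun _ => 1
  simpa using this.symm

open Classical in
lemma histProb_eq_integral (π : Strategy A) (s₀ : S) (n : ℕ)
    (h : (i : Finset.Iic n) → StateAction A) (θ : ParamPath A) :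
    histProb π s₀ n h θ =
      ∫ x, (if Preorder.frestrictLe n x = h then 1 else 0 : ℝ) ∂(pathMeasure π θ s₀) := by
  rw [integral_frestrictLe π θ s₀ n (fun h' => if h' = h then 1 else 0)]
  simp

open Classical in
lemma histProb_zero (π : Strategy A) (s₀ : S)
    (h : (i : Finset.Iic 0) → StateAction A) (θ : ParamPath A) :
    histProb π s₀ 0 h θ =
      ∑ a, π 0 Fin.elim0 s₀ a * (if (⟨s₀, a⟩ : StateAction A) = lastPair h then 1 else 0) := by
  rw [histProb_eq_integral, ← integral_eval_zero π θ s₀ fun y => if y = lastPair h then 1 else 0]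
  refine integral_congr_ae (ae_of_all _ fun x => ?_)
  have : Preorder.frestrictLe 0 x = h ↔ x 0 = lastPair h := by
    constructor
    · rintro rfl; rfl
    · intro e
      ext i : 1
      obtain ⟨i, hi⟩ := i
      obtain rfl : i = 0 := by simpa using hi
      exact e
  simp only [this]

-- The indicator selects the one-pair extension equal to `h`. The parameters enter the recursion
-- only through the transition vectors of epoch `n`, which gives both measurability and locality in
-- `θ` by induction; at length zero they do not enter at all.
open Classical in
lemma histProb_succ (π : Strategy A) (s₀ : S) (n : ℕ)
    (h : (i : Finset.Iic (n + 1)) → StateAction A) (θ : ParamPath A) :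
    histProb π s₀ (n + 1) h θ =
      ∑ g, histProb π s₀ n g θ *
        ∑ s, (θ ((lastPair g).state, n)).1 (lastPair g).action s *
          ∑ a, π (n + 1) (toFin g) s a *
            (if g = Preorder.frestrictLe₂ (π := fun _ => StateAction A) (Nat.le_succ n) h ∧
              (⟨s, a⟩ : StateAction A) = lastPair h then 1 else 0) := by
  rw [histProb_eq_integral, ← integral_frestrictLe π θ s₀ n fun g =>
    ∑ s, (θ ((lastPair g).state, n)).1 (lastPair g).action s *
          ∑ a, π (n + 1) (toFin g) s a *
            (if g = Preorder.frestrictLe₂ (π := fun _ => StateAction A) (Nat.le_succ n) h ∧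
              (⟨s, a⟩ : StateAction A) = lastPair h then 1 else 0)]
  refine Eq.trans ?_ (integral_succ π θ s₀ n fun g y =>
    if g = Preorder.frestrictLe₂ (π := fun _ => StateAction A) (Nat.le_succ n) h ∧
      y = lastPair h then 1 else 0)
  refine integral_congr_ae (ae_of_all _ fun x => ?_)
  have : Preorder.frestrictLe (n + 1) x = h ↔
      Preorder.frestrictLe n x =
        Preorder.frestrictLe₂ (π := fun _ => StateAction A) (Nat.le_succ n) h ∧
      x (n + 1) = lastPair h := by
    constructor
    · rintro rfl; exact ⟨rfl, rfl⟩
    · rintro ⟨e1, e2⟩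
      ext i : 1
      obtain ⟨i, hi⟩ := i
      rcases Nat.lt_or_eq_of_le (Finset.mem_Iic.1 hi) with hlt | rfl
      · exact congrFun e1 ⟨i, Finset.mem_Iic.2 (Nat.lt_succ_iff.1 hlt)⟩
      · exact e2
  simp only [this]

lemma measurable_histProb (π : Strategy A) (s₀ : S) (n : ℕ)
    (h : (i : Finset.Iic n) → StateAction A) : Measurable (histProb π s₀ n h) := by
  classical
  induction n with
  | zero => simp only [funext (histProb_zero π s₀ h), measurable_const]
  | succ n ih =>
    rw [funext (histProb_succ π s₀ n h)]
    refine Finset.measurable_sum _ fun g _ => (ih g).mul ?_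
    exact Finset.measurable_sum _ fun s _ => (measurable_transition _ _ _ _).mul_const _

/-- The inequality is strict: the history includes the action at epoch `n`, but the transition out
of epoch `n` has not yet been used. -/
lemma dependsOn_histProb (π : Strategy A) (s₀ : S) (n : ℕ)
    (h : (i : Finset.Iic n) → StateAction A) :
    DependsOn (histProb π s₀ n h) {x : S × ℕ | x.2 < n} := by
  classical
  intro θ θ' hθ
  induction n with
  | zero => rw [histProb_zero, histProb_zero]
  | succ n ih =>
    rw [histProb_succ, histProb_succ]
    refine Finset.sum_congr rfl fun g _ => ?_
    rw [ih g fun i hi => hθ i (Nat.lt_succ_of_lt hi),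
      hθ ((lastPair g).state, n) (Nat.lt_succ_self n)]

end Path

end DAMDP

namespace DAMDP

section Simplex

lemma sum_stdSimplex {ι : Type*} [Fintype ι] (d : stdSimplex ℝ ι) : ∑ i, d i = 1 := d.2.2

lemma abs_sum_stdSimplex_mul_le {ι : Type*} [Fintype ι] (d : stdSimplex ℝ ι) (f : ι → ℝ)
    {c : ℝ} (hf : ∀ i, |f i| ≤ c) : |∑ i, d i * f i| ≤ c := by
  calc |∑ i, d i * f i| ≤ ∑ i, |d i * f i| := Finset.abs_sum_le_sum_abs _ _
    _ ≤ ∑ i, d i * c := by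
      refine Finset.sum_le_sum fun i _ => ?_
      rw [abs_mul, abs_of_nonneg (show 0 ≤ d i from d.2.1 i)]
      exact mul_le_mul_of_nonneg_left (hf i) (d.2.1 i)
    _ = c := by rw [← Finset.sum_mul, sum_stdSimplex, one_mul]

end Simplex

/-! ### One-step values, advantages and telescoping. -/

section ActionValue

variable {S : Type*} [Fintype S] {A : S → Type*}

/-- The one-step value of a pure action. -/
noncomputable def actionValue (γ : ℝ) (v : S → ℝ) (s : S) (a : A s) (θ : Param A s) : ℝ :=
  θ.2 a + γ * ∑ s', θ.1 a s' * v s'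

lemma measurable_actionValue (γ : ℝ) (v : S → ℝ) (s : S) (a : A s) :
    Measurable (actionValue γ v s a) := by
  have h (s' : S) : Measurable fun q : stdSimplex ℝ S => q s' :=
    (measurable_pi_apply s').comp measurable_subtype_coe
  refine ((measurable_pi_apply a).comp measurable_snd).add (Measurable.const_mul ?_ _)
  exact Finset.measurable_sum _ fun s' _ =>
    ((h s').comp ((measurable_pi_apply a).comp measurable_fst)).mul_const _

lemma abs_le_sum_abs (v : S → ℝ) (s : S) : |v s| ≤ ∑ s, |v s| :=
  Finset.single_le_sum (f := fun s => |v s|) (fun _ _ => abs_nonneg _) (Finset.mem_univ s)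

lemma integrable_actionValue (γ : ℝ) (v : S → ℝ) (s : S) (a : A s)
    (ν : Measure (Param A s)) [IsFiniteMeasure ν] {R : ℝ} (hR : ∀ᵐ θ ∂ν, ∀ a, |θ.2 a| ≤ R) :
    Integrable (actionValue γ v s a) ν := by
  refine Integrable.of_bound (measurable_actionValue γ v s a).aestronglyMeasurable
    (R + |γ| * ∑ s, |v s|) ?_
  filter_upwards [hR] with θ hθ
  refine (abs_add_le _ _).trans (add_le_add (hθ a) ?_)
  rw [abs_mul]
  exact mul_le_mul_of_nonneg_left (abs_sum_stdSimplex_mul_le _ _ (abs_le_sum_abs v))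
    (abs_nonneg γ)

end ActionValue

section Bellman

variable {S : Type*} [Fintype S] {A : S → Type*} [∀ s, Fintype (A s)]

/-- The one-step advantage `r(s, a) + γ ∑ p(s' | s, a) v(s') - v(s)`. -/
noncomputable def advantage (γ : ℝ) (v : S → ℝ) (n : ℕ) (θ : ParamPath A)
    (y : StateAction A) : ℝ :=
  (θ (y.state, n)).2 y.action + γ * ∑ s', (θ (y.state, n)).1 y.action s' * v s' - v y.state

lemma sum_mul_advantage (γ : ℝ) (v : S → ℝ) (n : ℕ) (θ : ParamPath A) (s : S)
    (d : stdSimplex ℝ (A s)) :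
    ∑ a, d a * advantage γ v n θ ⟨s, a⟩ = oneStep γ v s d (θ (s, n)) - v s := by
  simp only [advantage, oneStep, mul_sub, Finset.sum_sub_distrib, ← Finset.sum_mul,
    sum_stdSimplex, one_mul]

/-- Telescoping of the discounted advantages along the decision process. -/
lemma sum_reward_eq (γ : ℝ) (v : S → ℝ) (π : Strategy A) (θ : ParamPath A) (s₀ : S) (N : ℕ) :
    ∑ t ∈ Finset.range N, γ ^ t * ∫ x, (θ ((x t).state, t)).2 (x t).action ∂(pathMeasure π θ s₀) =
      v s₀ - γ ^ N * ∫ x, v (x N).state ∂(pathMeasure π θ s₀) +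
        ∑ t ∈ Finset.range N, γ ^ t * ∫ x, advantage γ v t θ (x t) ∂(pathMeasure π θ s₀) := by
  induction N with
  | zero =>
    rw [integral_eval_zero π θ s₀ fun y => v y.state]
    simp [← Finset.sum_mul]
  | succ N ih =>
    rw [Finset.sum_range_succ, Finset.sum_range_succ, ih]
    -- The new boundary term equals the continuation part of the advantage at epoch `N`, so the two
    -- cancel.
    have h1 : ∫ x, v (x (N + 1)).state ∂(pathMeasure π θ s₀) =
        ∫ x, ∑ s', (θ ((x N).state, N)).1 (x N).action s' * v s' ∂(pathMeasure π θ s₀) := by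
      rw [integral_succ π θ s₀ N fun _ y => v y.state]
      simp only [← Finset.sum_mul, sum_stdSimplex, one_mul]
    have h2 : ∫ x, advantage γ v N θ (x N) ∂(pathMeasure π θ s₀) =
        ∫ x, (θ ((x N).state, N)).2 (x N).action ∂(pathMeasure π θ s₀) +
        γ * ∫ x, ∑ s', (θ ((x N).state, N)).1 (x N).action s' * v s' ∂(pathMeasure π θ s₀) -
        ∫ x, v (x N).state ∂(pathMeasure π θ s₀) := by
      have i1 := integrable_eval π θ s₀ N fun y => (θ (y.state, N)).2 y.action
      have i2 := integrable_eval π θ s₀ N fun y =>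
        γ * ∑ s', (θ (y.state, N)).1 y.action s' * v s'
      have i3 := integrable_eval π θ s₀ N fun y => v y.state
      simp only [advantage]
      rw [integral_sub (by exact i1.add i2) i3, integral_add i1 i2, integral_const_mul]
    rw [h1, h2]
    ring

lemma expected_advantage_zero (γ : ℝ) (v : S → ℝ) (π : Strategy A) (θ : ParamPath A) (s₀ : S) :
    ∫ x, advantage γ v 0 θ (x 0) ∂(pathMeasure π θ s₀) =
      oneStep γ v s₀ (π 0 Fin.elim0 s₀) (θ (s₀, 0)) - v s₀ := by
  rw [integral_eval_zero, sum_mul_advantage]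

/-- The probability of a history followed by a transition to a given state. -/
noncomputable def reachProb (π : Strategy A) (s₀ : S) (n : ℕ)
    (h : (i : Finset.Iic n) → StateAction A) (s : S) (θ : ParamPath A) : ℝ :=
  histProb π s₀ n h θ * (θ ((lastPair h).state, n)).1 (lastPair h).action s

lemma expected_advantage_succ (γ : ℝ) (v : S → ℝ) (π : Strategy A) (θ : ParamPath A) (s₀ : S)
    (n : ℕ) :
    ∫ x, advantage γ v (n + 1) θ (x (n + 1)) ∂(pathMeasure π θ s₀) =
      ∑ h, ∑ s, reachProb π s₀ n h s θ *
        (oneStep γ v s (π (n + 1) (toFin h) s) (θ (s, n + 1)) - v s) := by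
  rw [integral_succ π θ s₀ n fun _ y => advantage γ v (n + 1) θ y]
  simp only [sum_mul_advantage]
  refine (integral_frestrictLe π θ s₀ n fun h => ∑ s,
    (θ ((lastPair h).state, n)).1 (lastPair h).action s *
      (oneStep γ v s (π (n + 1) (toFin h) s) (θ (s, n + 1)) - v s)).trans ?_
  simp only [reachProb, Finset.mul_sum, mul_assoc]

lemma sum_reachProb (π : Strategy A) (s₀ : S) (n : ℕ) (θ : ParamPath A) :
    ∑ h, ∑ s, reachProb π s₀ n h s θ = 1 := by
  simp only [reachProb, ← Finset.mul_sum, sum_stdSimplex, mul_one, sum_histProb]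

lemma reachProb_nonneg (π : Strategy A) (s₀ : S) (n : ℕ)
    (h : (i : Finset.Iic n) → StateAction A) (s : S) (θ : ParamPath A) :
    0 ≤ reachProb π s₀ n h s θ :=
  mul_nonneg (histProb_nonneg π s₀ n h θ) (((θ _).1 _).2.1 s)

lemma reachProb_le_one (π : Strategy A) (s₀ : S) (n : ℕ)
    (h : (i : Finset.Iic n) → StateAction A) (s : S) (θ : ParamPath A) :
    reachProb π s₀ n h s θ ≤ 1 :=
  mul_le_one₀ (histProb_le_one π s₀ n h θ) (((θ _).1 _).2.1 s)
    ((Finset.single_le_sum (fun i _ => ((θ _).1 _).2.1 i) (Finset.mem_univ s)).trans_eq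
      ((θ _).1 _).2.2)

lemma measurable_reachProb (π : Strategy A) (s₀ : S) (n : ℕ)
    (h : (i : Finset.Iic n) → StateAction A) (s : S) : Measurable (reachProb π s₀ n h s) :=
  (measurable_histProb π s₀ n h).mul (measurable_transition _ _ _ _)

/-- Reaching a state at epoch `n + 1` uses epoch `n` but not epoch `n + 1`; this gap is what makes
the product structure applicable. -/
lemma dependsOn_reachProb (π : Strategy A) (s₀ : S) (n : ℕ)
    (h : (i : Finset.Iic n) → StateAction A) (s : S) :
    DependsOn (reachProb π s₀ n h s) {x : S × ℕ | x.2 ≤ n} := by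
  intro θ θ' hθ
  rw [reachProb, reachProb, hθ ((lastPair h).state, n) (le_refl n),
    dependsOn_histProb π s₀ n h fun i hi => hθ i (Nat.le_of_lt hi)]

lemma measurable_oneStep (γ : ℝ) (v : S → ℝ) (s : S) (d : stdSimplex ℝ (A s)) :
    Measurable (oneStep γ v s d) :=
  Finset.measurable_sum _ fun a _ => (measurable_actionValue γ v s a).const_mul _

lemma integrable_oneStep (γ : ℝ) (v : S → ℝ) (s : S) (d : stdSimplex ℝ (A s))
    (ν : Measure (Param A s)) [IsFiniteMeasure ν] {R : ℝ} (hR : ∀ᵐ θ ∂ν, ∀ a, |θ.2 a| ≤ R) :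
    Integrable (oneStep γ v s d) ν :=
  integrable_finsetSum _ fun a _ => (integrable_actionValue γ v s a ν hR).const_mul _

lemma integral_oneStep (γ : ℝ) (v : S → ℝ) (s : S) (d : stdSimplex ℝ (A s))
    (ν : Measure (Param A s)) [IsFiniteMeasure ν] {R : ℝ} (hR : ∀ᵐ θ ∂ν, ∀ a, |θ.2 a| ≤ R) :
    ∫ θ, oneStep γ v s d θ ∂ν = ∑ a, d a * ∫ θ, actionValue γ v s a θ ∂ν := by
  refine (integral_finsetSum _ fun a _ =>
    (integrable_actionValue γ v s a ν hR).const_mul (d a)).trans ?_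
  simp only [integral_const_mul]

end Bellman

/-! ### Independence under product laws and averaging of advantages. -/

section Independence

/-- In a product of probability measures, a functional of finitely many coordinates is independent
of each of the other coordinates. -/
lemma integral_infinitePi_mul_of_dependsOn {ι : Type*} {E : ι → Type*}
    [∀ i, MeasurableSpace (E i)] (ν : ∀ i, Measure (E i)) [∀ i, IsProbabilityMeasure (ν i)]
    {f : (∀ i, E i) → ℝ} (hf : Measurable f) {T : Finset ι} (hfT : DependsOn f T)
    {j : ι} (hj : j ∉ T) {g : E j → ℝ} (hg : Measurable g) :
    ∫ x, f x * g (x j) ∂(Measure.infinitePi ν) =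
      (∫ x, f x ∂(Measure.infinitePi ν)) * ∫ y, g y ∂(ν j) := by
  classical
  obtain ⟨x₀⟩ : Nonempty (∀ i, E i) := ⟨fun i => (ν i).nonempty_of_neZero.some⟩
  have hind : iIndepFun (fun i (x : ∀ i, E i) => x i) (Measure.infinitePi ν) :=
    iIndepFun_infinitePi (X := fun i (y : E i) => y) fun i => measurable_id
  have h1 := hind.indepFun_finset T {j} (by simpa using hj) fun i => measurable_pi_apply i
  have hψ : Measurable fun y : (i : ({j} : Finset ι)) → E i =>
      g (y ⟨j, Finset.mem_singleton_self j⟩) :=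
    hg.comp (measurable_pi_apply (⟨j, Finset.mem_singleton_self j⟩ : ({j} : Finset ι)))
  -- Freezing the coordinates outside `T` at `x₀` exhibits `f` as a function of the restriction to
  -- `T`.
  have h2 := h1.comp (φ := fun y : (i : T) → E i => f (Function.updateFinset x₀ T y))
    (hf.comp measurable_updateFinset) hψ
  have h3 : ((fun y => f (Function.updateFinset x₀ T y)) ∘
      fun (x : ∀ i, E i) (i : T) => x i) = f := by
    funext x
    exact hfT fun i hi => by simp [Function.updateFinset, Finset.mem_coe.1 hi]
  rw [h3] at h2
  have h4 := h2.integral_fun_mul_eq_mul_integral hf.aestronglyMeasurable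
    (hg.comp (measurable_pi_apply j)).aestronglyMeasurable
  refine h4.trans ?_
  congr 1
  rw [← Measure.infinitePi_map_eval ν j,
    integral_map (measurable_pi_apply j).aemeasurable hg.aestronglyMeasurable]
  rfl

end Independence

section Expectation

variable {S : Type*} [Fintype S] {A : S → Type*} [∀ s, Fintype (A s)]

/-- Integrability of the one-step value at an augmented state under a product law. -/
lemma integrable_oneStep_eval (γ : ℝ) (v : S → ℝ) (s : S) (n : ℕ)
    (d : stdSimplex ℝ (A s)) (ν : (x : S × ℕ) → ProbabilityMeasure (Param A x.1)) {R : ℝ}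
    (hR : ∀ x, ∀ᵐ θ ∂(ν x : Measure (Param A x.1)), ∀ a, |θ.2 a| ≤ R) :
    Integrable (fun θ : ParamPath A => oneStep γ v s d (θ (s, n)))
      (Measure.infinitePi fun x => (ν x : Measure (Param A x.1))) :=
  (measurePreserving_eval_infinitePi
    (fun x => (ν x : Measure (Param A x.1))) (s, n)).integrable_comp_of_integrable
    (integrable_oneStep γ v s d _ (hR (s, n)))

lemma integral_oneStep_eval (γ : ℝ) (v : S → ℝ) (s : S) (n : ℕ)
    (d : stdSimplex ℝ (A s)) (ν : (x : S × ℕ) → ProbabilityMeasure (Param A x.1)) :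
    ∫ θ : ParamPath A, oneStep γ v s d (θ (s, n))
      ∂(Measure.infinitePi fun x => (ν x : Measure (Param A x.1))) =
    ∫ θ, oneStep γ v s d θ ∂(ν (s, n) : Measure (Param A s)) := by
  have h := integral_map (μ := Measure.infinitePi fun x => (ν x : Measure (Param A x.1)))
    (measurable_pi_apply (s, n)).aemeasurable (measurable_oneStep γ v s d).aestronglyMeasurable
  rw [Measure.infinitePi_map_eval] at h
  exact h.symm

lemma integrable_reachProb_mul (π : Strategy A) (s₀ : S) (n : ℕ)
    (h : (i : Finset.Iic n) → StateAction A) (s : S) {μ : Measure (ParamPath A)}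
    {g : ParamPath A → ℝ} (hg : Integrable g μ) :
    Integrable (fun θ => reachProb π s₀ n h s θ * g θ) μ :=
  hg.bdd_mul (c := 1) (measurable_reachProb π s₀ n h s).aestronglyMeasurable
    (ae_of_all _ fun θ => by
      rw [Real.norm_of_nonneg (reachProb_nonneg π s₀ n h s θ)]
      exact reachProb_le_one π s₀ n h s θ)

lemma integrable_expected_advantage (γ : ℝ) (v : S → ℝ) (π : Strategy A) (s₀ : S)
    (n : ℕ) (ν : (x : S × ℕ) → ProbabilityMeasure (Param A x.1)) {R : ℝ}
    (hR : ∀ x, ∀ᵐ θ ∂(ν x : Measure (Param A x.1)), ∀ a, |θ.2 a| ≤ R) :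
    Integrable (fun θ => ∫ x, advantage γ v n θ (x n) ∂(pathMeasure π θ s₀))
      (Measure.infinitePi fun x => (ν x : Measure (Param A x.1))) := by
  cases n with
  | zero =>
    simp only [expected_advantage_zero]
    exact (integrable_oneStep_eval γ v s₀ 0 _ ν hR).sub (integrable_const _)
  | succ n =>
    simp only [expected_advantage_succ]
    refine integrable_finsetSum _ fun h _ => integrable_finsetSum _ fun s _ => ?_
    exact integrable_reachProb_mul _ _ _ _ _
      ((integrable_oneStep_eval γ v s (n + 1) _ ν hR).sub (integrable_const _))

/-- The expected advantage at an epoch is an average of the expected advantages of the randomized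
actions that the strategy takes after the histories of that length. -/
lemma integral_expected_advantage_mem (γ : ℝ) (v : S → ℝ) (π : Strategy A) (s₀ : S)
    (n : ℕ) (ν : (x : S × ℕ) → ProbabilityMeasure (Param A x.1)) {R : ℝ}
    (hR : ∀ x, ∀ᵐ θ ∂(ν x : Measure (Param A x.1)), ∀ a, |θ.2 a| ≤ R)
    {I : Set ℝ} (hI : Convex ℝ I)
    (hmem : ∀ h s, ∫ θ, oneStep γ v s (π n h s) θ ∂(ν (s, n) : Measure (Param A s)) - v s ∈ I) :
    ∫ θ, ∫ x, advantage γ v n θ (x n) ∂(pathMeasure π θ s₀)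
      ∂(Measure.infinitePi fun x => (ν x : Measure (Param A x.1))) ∈ I := by
  set μ := Measure.infinitePi fun x => (ν x : Measure (Param A x.1)) with hμ
  cases n with
  | zero =>
    simp only [expected_advantage_zero]
    rw [integral_sub (integrable_oneStep_eval γ v s₀ 0 _ ν hR) (integrable_const _),
      integral_oneStep_eval]
    simpa using hmem Fin.elim0 s₀
  | succ n =>
    have hint (h : (i : Finset.Iic n) → StateAction A) (s : S) :
        Integrable (fun θ => reachProb π s₀ n h s θ *
          (oneStep γ v s (π (n + 1) (toFin h) s) (θ (s, n + 1)) - v s)) μ :=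
      integrable_reachProb_mul _ _ _ _ _
        ((integrable_oneStep_eval γ v s (n + 1) _ ν hR).sub (integrable_const _))
    have hprob (h : (i : Finset.Iic n) → StateAction A) (s : S) :
        Integrable (reachProb π s₀ n h s) μ := by
      simpa using integrable_reachProb_mul π s₀ n h s (μ := μ) (integrable_const (1 : ℝ))
    -- The reach probability lives on the finitely many augmented states of epochs at most `n`,
    -- which exclude `(s, n + 1)`, so the expectation factors.
    have hterm (h : (i : Finset.Iic n) → StateAction A) (s : S) :
        ∫ θ, reachProb π s₀ n h s θ *
          (oneStep γ v s (π (n + 1) (toFin h) s) (θ (s, n + 1)) - v s) ∂μ =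
        (∫ θ, reachProb π s₀ n h s θ ∂μ) *
          (∫ θ, oneStep γ v s (π (n + 1) (toFin h) s) θ ∂(ν (s, n + 1) : Measure (Param A s)) -
            v s) := by
      have h1 := integral_infinitePi_mul_of_dependsOn
        (fun x : S × ℕ => (ν x : Measure (Param A x.1)))
        (measurable_reachProb π s₀ n h s) (T := Finset.univ ×ˢ Finset.range (n + 1))
        (fun θ θ' hθ => dependsOn_reachProb π s₀ n h s fun i hi => hθ i (by
          simpa [Nat.lt_succ_iff] using hi))
        (j := (s, n + 1)) (by simp)
        (g := fun θ => oneStep γ v s (π (n + 1) (toFin h) s) θ - v s)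
        ((measurable_oneStep γ v s _).sub_const _)
      refine h1.trans ?_
      rw [integral_sub (integrable_oneStep γ v s _ _ (hR (s, n + 1))) (integrable_const _)]
      simp [hμ]
    simp only [expected_advantage_succ]
    rw [integral_finsetSum _ fun h _ => integrable_finsetSum _ fun s _ => hint h s]
    simp only [integral_finsetSum _ fun s _ => hint _ s, hterm]
    rw [← Fintype.sum_prod_type']
    -- The expected reach probabilities are convex weights. A general convex `I` serves both
    -- half-lines needed later.
    refine hI.sum_mem (fun x _ => integral_nonneg fun θ => reachProb_nonneg _ _ _ _ _ θ) ?_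
      fun x _ => hmem _ _
    rw [Fintype.sum_prod_type (f := fun x : ((i : Finset.Iic n) → StateAction A) × S =>
      ∫ θ, reachProb π s₀ n x.1 x.2 θ ∂μ)]
    simp only [← integral_finsetSum _ fun s _ => hprob _ s]
    rw [← integral_finsetSum _ fun h _ => integrable_finsetSum _ fun s _ => hprob h s]
    simp [sum_reachProb]

end Expectation

end DAMDP

namespace DAMDP

/-! ### Passage to the infinite horizon. -/

section Performance

open Filter Topology

variable {S : Type*} [Fintype S] {A : S → Type*} [∀ s, Fintype (A s)]

lemma abs_integral_reward_le (π : Strategy A) (θ : ParamPath A) (s₀ : S) {R : ℝ}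
    (hR : ∀ x a, |(θ x).2 a| ≤ R) (t : ℕ) :
    |∫ x, (θ ((x t).state, t)).2 (x t).action ∂(pathMeasure π θ s₀)| ≤ R := by
  have h : ∀ᵐ x ∂(pathMeasure π θ s₀), ‖(θ ((x t).state, t)).2 (x t).action‖ ≤ R :=
    ae_of_all _ fun x => hR ((x t).state, t) (x t).action
  simpa using norm_integral_le_of_norm_le_const h

lemma hasSum_expected_reward {γ : ℝ} (hγ0 : 0 ≤ γ) (hγ1 : γ < 1) (π : Strategy A)
    (θ : ParamPath A) (s₀ : S) {R : ℝ} (hR : ∀ x a, |(θ x).2 a| ≤ R) :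
    HasSum (fun t => γ ^ t * ∫ x, (θ ((x t).state, t)).2 (x t).action ∂(pathMeasure π θ s₀))
      (u γ π θ s₀) := by
  have hint (t : ℕ) : Integrable (fun x => γ ^ t * (θ ((x t).state, t)).2 (x t).action)
      (pathMeasure π θ s₀) :=
    integrable_eval π θ s₀ t fun y => γ ^ t * (θ (y.state, t)).2 y.action
  have h := hasSum_integral_of_summable_integral_norm hint ?_
  · simp only [integral_const_mul] at h
    exact h
  · refine Summable.of_nonneg_of_le (fun t => integral_nonneg fun x => norm_nonneg _) (fun t => ?_)
      ((summable_geometric_of_lt_one hγ0 hγ1).mul_right R)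
    have hb := integral_mono (hint t).norm (integrable_const (γ ^ t * R)) fun x => by
      rw [norm_mul, Real.norm_of_nonneg (pow_nonneg hγ0 t)]
      exact mul_le_mul_of_nonneg_left (hR ((x t).state, t) (x t).action) (pow_nonneg hγ0 t)
    simpa using hb

lemma abs_sum_discounted_le {γ : ℝ} (hγ0 : 0 ≤ γ) (hγ1 : γ < 1) {R : ℝ} {f : ℕ → ℝ}
    (hf : ∀ t, |f t| ≤ R) (N : ℕ) : |∑ t ∈ Finset.range N, γ ^ t * f t| ≤ R / (1 - γ) := by
  have hR : 0 ≤ R := (abs_nonneg _).trans (hf 0)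
  calc |∑ t ∈ Finset.range N, γ ^ t * f t| ≤ ∑ t ∈ Finset.range N, |γ ^ t * f t| :=
        Finset.abs_sum_le_sum_abs _ _
    _ ≤ ∑ t ∈ Finset.range N, γ ^ t * R := by
        refine Finset.sum_le_sum fun t _ => ?_
        rw [abs_mul, abs_of_nonneg (pow_nonneg hγ0 t)]
        exact mul_le_mul_of_nonneg_left (hf t) (pow_nonneg hγ0 t)
    _ = (∑ t ∈ Finset.range N, γ ^ t) * R := by rw [Finset.sum_mul]
    _ ≤ (1 - γ)⁻¹ * R := by
        refine mul_le_mul_of_nonneg_right ?_ hR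
        rw [← tsum_geometric_of_lt_one hγ0 hγ1]
        exact (summable_geometric_of_lt_one hγ0 hγ1).sum_le_tsum _ fun t _ => pow_nonneg hγ0 t
    _ = R / (1 - γ) := by rw [div_eq_inv_mul]

/-- The performance exceeds the initial value by the discounted sum of the expected advantages. -/
lemma tendsto_sum_expected_advantage {γ : ℝ} (hγ0 : 0 ≤ γ) (hγ1 : γ < 1) (v : S → ℝ)
    (π : Strategy A) (s₀ : S) (ν : (x : S × ℕ) → ProbabilityMeasure (Param A x.1)) {R : ℝ}
    (hR : ∀ x, ∀ᵐ θ ∂(ν x : Measure (Param A x.1)), ∀ a, |θ.2 a| ≤ R) :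
    Tendsto (fun N => v s₀ + ∑ t ∈ Finset.range N, γ ^ t *
        ∫ θ, ∫ x, advantage γ v t θ (x t) ∂(pathMeasure π θ s₀)
          ∂(Measure.infinitePi fun x => (ν x : Measure (Param A x.1)))) atTop
      (𝓝 (w γ π (Measure.infinitePi fun x => (ν x : Measure (Param A x.1))) s₀)) := by
  set μ := Measure.infinitePi fun x => (ν x : Measure (Param A x.1)) with hμ
  have hint (t : ℕ) : Integrable (fun θ => γ ^ t *
      ∫ x, advantage γ v t θ (x t) ∂(pathMeasure π θ s₀)) μ :=
    (integrable_expected_advantage γ v π s₀ t ν hR).const_mul _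
  -- There are countably many augmented states, so the almost sure bounds hold simultaneously.
  have hbd : ∀ᵐ θ ∂μ, ∀ x a, |(θ x).2 a| ≤ R := by
    refine ae_all_iff.2 fun x => ?_
    exact (measurePreserving_eval_infinitePi
      (fun x => (ν x : Measure (Param A x.1))) x).quasiMeasurePreserving.ae (hR x)
  have hval (θ : ParamPath A) (N : ℕ) :
      |∫ x, v (x N).state ∂(pathMeasure π θ s₀)| ≤ ∑ s, |v s| := by
    have h : ∀ᵐ x ∂(pathMeasure π θ s₀), ‖v (x N).state‖ ≤ ∑ s, |v s| :=
      ae_of_all _ fun x => abs_le_sum_abs v (x N).state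
    simpa using norm_integral_le_of_norm_le_const h
  -- In this form the partial sums are visibly bounded by `R / (1 - γ) + ∑ s, |v s|` and converge to
  -- `u`, as dominated convergence requires.
  have hkey (θ : ParamPath A) (N : ℕ) :
      v s₀ + ∑ t ∈ Finset.range N, γ ^ t * ∫ x, advantage γ v t θ (x t) ∂(pathMeasure π θ s₀) =
        ∑ t ∈ Finset.range N,
          γ ^ t * ∫ x, (θ ((x t).state, t)).2 (x t).action ∂(pathMeasure π θ s₀) +
        γ ^ N * ∫ x, v (x N).state ∂(pathMeasure π θ s₀) := by
    rw [sum_reward_eq γ v]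
    ring
  have hconv := tendsto_integral_of_dominated_convergence (μ := μ)
    (F := fun N θ => v s₀ + ∑ t ∈ Finset.range N, γ ^ t *
      ∫ x, advantage γ v t θ (x t) ∂(pathMeasure π θ s₀))
    (f := fun θ => u γ π θ s₀) (fun _ => R / (1 - γ) + ∑ s, |v s|)
    (fun N => ((integrable_const _).add
      (integrable_finsetSum _ fun t _ => hint t)).aestronglyMeasurable)
    (integrable_const _) ?_ ?_
  · refine hconv.congr fun N => ?_
    rw [integral_add (integrable_const _) (integrable_finsetSum _ fun t _ => hint t),
      integral_finsetSum _ fun t _ => hint t]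
    simp only [integral_const_mul]
    simp
  · intro N
    filter_upwards [hbd] with θ hθ
    rw [hkey]
    refine (norm_add_le _ _).trans (add_le_add
      (abs_sum_discounted_le hγ0 hγ1 (abs_integral_reward_le π θ s₀ hθ) N) ?_)
    rw [norm_mul, Real.norm_of_nonneg (pow_nonneg hγ0 N)]
    exact (mul_le_of_le_one_left (norm_nonneg _) (pow_le_one₀ hγ0 hγ1.le)).trans (hval θ N)
  · filter_upwards [hbd] with θ hθ
    simp only [hkey]
    have h1 := (hasSum_expected_reward hγ0 hγ1 π θ s₀ hθ).tendsto_sum_nat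
    have h2 : Tendsto (fun N => γ ^ N * ∫ x, v (x N).state ∂(pathMeasure π θ s₀)) atTop (𝓝 0) := by
      refine squeeze_zero_norm (a := fun N => γ ^ N * ∑ s, |v s|) (fun N => ?_) ?_
      · rw [norm_mul, Real.norm_of_nonneg (pow_nonneg hγ0 N)]
        exact mul_le_mul_of_nonneg_left (hval θ N) (pow_nonneg hγ0 N)
      · simpa using (tendsto_pow_atTop_nhds_zero_of_lt_one hγ0 hγ1).mul_const (∑ s, |v s|)
    simpa using h1.add h2

/-- A strategy whose randomized actions all have a one-step value of at least `v` under the law of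
the parameters has a performance of at least `v`. -/
lemma le_performance {γ : ℝ} (hγ0 : 0 ≤ γ) (hγ1 : γ < 1) (v : S → ℝ) (π : Strategy A) (s₀ : S)
    (ν : (x : S × ℕ) → ProbabilityMeasure (Param A x.1)) {R : ℝ}
    (hR : ∀ x, ∀ᵐ θ ∂(ν x : Measure (Param A x.1)), ∀ a, |θ.2 a| ≤ R)
    (h : ∀ n g s, v s ≤ ∫ θ, oneStep γ v s (π n g s) θ ∂(ν (s, n) : Measure (Param A s))) :
    v s₀ ≤ w γ π (Measure.infinitePi fun x => (ν x : Measure (Param A x.1))) s₀ := by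
  refine ge_of_tendsto' (tendsto_sum_expected_advantage hγ0 hγ1 v π s₀ ν hR) fun N => ?_
  refine le_add_of_nonneg_right (Finset.sum_nonneg fun t _ => mul_nonneg (pow_nonneg hγ0 t) ?_)
  exact integral_expected_advantage_mem γ v π s₀ t ν hR (convex_Ici 0)
    fun g s => sub_nonneg.2 (h t g s)

/-- A strategy whose randomized actions all have a one-step value of at most `v + ε` under the law
of the parameters has a performance of at most `v + ε / (1 - γ)`. -/
lemma performance_le {γ : ℝ} (hγ0 : 0 ≤ γ) (hγ1 : γ < 1) (v : S → ℝ) (π : Strategy A) (s₀ : S)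
    (ν : (x : S × ℕ) → ProbabilityMeasure (Param A x.1)) {R : ℝ}
    (hR : ∀ x, ∀ᵐ θ ∂(ν x : Measure (Param A x.1)), ∀ a, |θ.2 a| ≤ R) {ε : ℝ} (hε : 0 ≤ ε)
    (h : ∀ n g s, ∫ θ, oneStep γ v s (π n g s) θ ∂(ν (s, n) : Measure (Param A s)) ≤ v s + ε) :
    w γ π (Measure.infinitePi fun x => (ν x : Measure (Param A x.1))) s₀ ≤
      v s₀ + ε / (1 - γ) := by
  refine le_of_tendsto' (tendsto_sum_expected_advantage hγ0 hγ1 v π s₀ ν hR) fun N => ?_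
  refine add_le_add_right (le_trans (b := ∑ t ∈ Finset.range N, γ ^ t * ε)
    (Finset.sum_le_sum fun t _ => mul_le_mul_of_nonneg_left ?_ (pow_nonneg hγ0 t)) ?_) _
  · exact integral_expected_advantage_mem γ v π s₀ t ν hR (convex_Iic ε)
      fun g s => sub_le_iff_le_add'.2 (h t g s)
  · exact (le_abs_self _).trans
      (abs_sum_discounted_le hγ0 hγ1 (fun _ => (abs_of_nonneg hε).le) N)

end Performance

/-! ### Minimax: one law against all randomized actions. -/

section Minimax

/-- A minimax theorem for a convex set and a simplex in finite dimension. -/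
lemma exists_mem_forall_lt_of_forall_stdSimplex {ι : Type*} [Fintype ι] [Nonempty ι]
    {M : Set (ι → ℝ)} (hM : Convex ℝ M) {c : ℝ}
    (h : ∀ d : stdSimplex ℝ ι, ∃ m ∈ M, ∑ i, d i * m i < c) : ∃ m ∈ M, ∀ i, m i < c := by
  classical
  by_contra! hcon
  -- If the conclusion fails, `M` misses this open orthant and a functional `f` with coefficients
  -- `W` separates them; `W`, normalized, is the mixed action contradicting `h`.
  have hU : Convex ℝ (Set.univ.pi fun _ : ι => Set.Iio c) := convex_pi fun _ _ => convex_Iio c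
  obtain ⟨f, b, hfU, hfM⟩ := geometric_hahn_banach_open hU
    (isOpen_set_pi Set.finite_univ fun _ _ => isOpen_Iio) hM (Set.disjoint_left.2 fun x hx hxM => by
      obtain ⟨i, hi⟩ := hcon x hxM
      exact absurd (hx i trivial) (not_lt.2 hi))
  set W : ι → ℝ := fun i => f (Pi.single i 1)
  have hf (x : ι → ℝ) : f x = ∑ i, W i * x i := by
    conv_lhs => rw [← Finset.univ_sum_single x, map_sum]
    refine Finset.sum_congr rfl fun i _ => ?_
    rw [mul_comm, ← smul_eq_mul, ← map_smul, ← Pi.single_smul', smul_eq_mul, mul_one]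
  have hconst (r : ℝ) (hr : r < c) : (∑ i, W i) * r < b := by
    rw [Finset.sum_mul, ← hf fun _ => r]
    exact hfU _ fun i _ => hr
  -- The orthant is unbounded below in every coordinate, so a negative coefficient would make `f`
  -- exceed `b` there; `t` is large enough that the gain `|b - f x₀|` does so.
  have hW (i : ι) : 0 ≤ W i := by
    by_contra! hi
    set x₀ : ι → ℝ := fun _ => c - 1
    set t : ℝ := |b - f x₀| / (-W i)
    have ht : 0 ≤ t := div_nonneg (abs_nonneg _) (by linarith)
    have h1 : f (x₀ - t • Pi.single i 1) < b := by
      refine hfU _ fun j _ => ?_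
      have : 0 ≤ t * (Pi.single i (1 : ℝ) : ι → ℝ) j :=
        mul_nonneg ht (by by_cases hj : j = i <;> simp [hj])
      simp only [Pi.sub_apply, Pi.smul_apply, smul_eq_mul, Set.mem_Iio, x₀]
      linarith
    rw [map_sub, map_smul, smul_eq_mul] at h1
    have h2 : t * f (Pi.single i 1) = -|b - f x₀| := by
      change |b - f x₀| / (-W i) * W i = _
      field_simp [hi.ne]
    have := le_abs_self (b - f x₀)
    linarith
  -- If `f` vanished, the orthant would give `0 < b` and a point of `M` would give `b ≤ 0`.
  have hWpos : 0 < ∑ i, W i := by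
    refine lt_of_le_of_ne (Finset.sum_nonneg fun i _ => hW i) fun h0 => ?_
    obtain ⟨m, hm, -⟩ := h (Classical.arbitrary _)
    have h1 : ∀ i, W i = 0 := fun i =>
      (Finset.sum_eq_zero_iff_of_nonneg fun i _ => hW i).1 h0.symm i (Finset.mem_univ i)
    have h2 := hconst (c - 1) (by linarith)
    have h3 := hfM m hm
    simp only [hf, h1, zero_mul, Finset.sum_const_zero] at h2 h3
    linarith
  obtain ⟨m, hm, hlt⟩ := h ⟨fun i => W i / ∑ i, W i, fun i => div_nonneg (hW i) hWpos.le, by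
    rw [← Finset.sum_div, div_self hWpos.ne']⟩
  -- Evaluate `f` on the constant vector whose entry is the weighted mean of `m`: its value is `f
  -- m`.
  have h1 := hconst _ hlt
  have h2 := hfM m hm
  have h3 : (∑ i, W i) * ∑ i, W i / (∑ i, W i) * m i = f m := by
    rw [hf, Finset.mul_sum]
    refine Finset.sum_congr rfl fun i _ => ?_
    field_simp
  exact absurd (h3 ▸ h1) (not_lt.2 h2)

variable {S : Type*} [Fintype S] {A : S → Type*} [∀ s, Fintype (A s)]

/-- A single law is almost worst for all randomized actions of a state. -/
lemma exists_law_forall_oneStep_le (γ : ℝ) (v : S → ℝ) (s : S) [Nonempty (A s)]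
    {C : Set (ProbabilityMeasure (Param A s))}
    (hC : ∀ μ ∈ C, ∀ ν ∈ C, ∀ a b : ℝ, 0 ≤ a → 0 ≤ b → a + b = 1 → ∃ κ ∈ C,
      (κ : Measure (Param A s)) = ENNReal.ofReal a • (μ : Measure (Param A s)) +
        ENNReal.ofReal b • (ν : Measure (Param A s)))
    {R : ℝ} (hR : ∀ ν ∈ C, ∀ᵐ θ ∂(ν : Measure (Param A s)), ∀ a, |θ.2 a| ≤ R)
    {c : ℝ} (hc : ∀ d, worstCase γ v s C d < c) :
    ∃ ν ∈ C, ∀ d, ∫ θ, oneStep γ v s d θ ∂(ν : Measure (Param A s)) ≤ c := by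
  let m (ν : ProbabilityMeasure (Param A s)) (a : A s) : ℝ :=
    ∫ θ, actionValue γ v s a θ ∂(ν : Measure (Param A s))
  -- The one-step value is linear in the action with coefficients `m ν`, so only this image in `A s
  -- → ℝ` matters; mixtures of laws make it convex.
  have hconv : Convex ℝ (m '' C) := by
    rintro _ ⟨μ, hμ, rfl⟩ _ ⟨ν, hν, rfl⟩ a b ha hb hab
    obtain ⟨κ, hκ, hκe⟩ := hC μ hμ ν hν a b ha hb hab
    refine ⟨κ, hκ, funext fun i => ?_⟩
    simp only [m, hκe]
    rw [integral_add_measure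
      ((integrable_actionValue γ v s i _ (hR μ hμ)).smul_measure ENNReal.ofReal_ne_top)
      ((integrable_actionValue γ v s i _ (hR ν hν)).smul_measure ENNReal.ofReal_ne_top),
      integral_smul_measure, integral_smul_measure, ENNReal.toReal_ofReal ha,
      ENNReal.toReal_ofReal hb]
    rfl
  obtain ⟨_, ⟨ν, hν, rfl⟩, hlt⟩ := exists_mem_forall_lt_of_forall_stdSimplex hconv (c := c)
    fun d => by
      obtain ⟨ν, hν⟩ := iInf_lt_iff.1 (hc d)
      obtain ⟨hνC, hν⟩ := iInf_lt_iff.1 hν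
      refine ⟨m ν, ⟨ν, hνC, rfl⟩, ?_⟩
      rw [← integral_oneStep γ v s d _ (hR ν hνC)]
      exact EReal.coe_lt_coe_iff.1 hν
  refine ⟨ν, hν, fun d => ?_⟩
  rw [integral_oneStep γ v s d _ (hR ν hν)]
  calc ∑ a, d a * m ν a ≤ ∑ a, d a * c :=
        Finset.sum_le_sum fun a _ => mul_le_mul_of_nonneg_left (hlt a).le (d.2.1 a)
    _ = c := by rw [← Finset.sum_mul, sum_stdSimplex, one_mul]

end Minimax

/-! ### Mixtures and bounded rewards in the ambiguity sets. -/

namespace AmbiguityData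

lemma measurable_forget {S : Type*} [Fintype S] {A : S → Type*} {s : S} {Q : ℕ} :
    Measurable fun θ : LiftedParam A s Q => ((θ.1, θ.2.1) : Param A s) :=
  measurable_fst.prodMk (measurable_fst.comp measurable_snd)

variable {S : Type*} [Fintype S] {A : S → Type*} {s : S} [Fintype (A s)]

/-- Means and probabilities are affine in the law, and the constraints confine them to a point and
to intervals. -/
lemma lifted_mixture (X : AmbiguityData A s) {μ ν : ProbabilityMeasure (LiftedParam A s X.Q)}
    (hμ : μ ∈ X.lifted) (hν : ν ∈ X.lifted) {a b : ℝ} (ha : 0 ≤ a) (hb : 0 ≤ b)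
    (hab : a + b = 1) : ∃ κ ∈ X.lifted,
      (κ : Measure (LiftedParam A s X.Q)) =
        ENNReal.ofReal a • (μ : Measure (LiftedParam A s X.Q)) +
        ENNReal.ofReal b • (ν : Measure (LiftedParam A s X.Q)) := by
  obtain ⟨hμi, hμc, hμp⟩ := hμ
  obtain ⟨hνi, hνc, hνp⟩ := hν
  have hi1 := hμi.smul_measure (c := ENNReal.ofReal a) ENNReal.ofReal_ne_top
  have hi2 := hνi.smul_measure (c := ENNReal.ofReal b) ENNReal.ofReal_ne_top
  refine ⟨⟨_, ⟨?_⟩⟩, ⟨hi1.add_measure hi2, ?_, fun i => ?_⟩, rfl⟩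
  · simp [← ENNReal.ofReal_add ha hb, hab]
  · simp only [ProbabilityMeasure.coe_mk]
    rw [integral_add_measure hi1 hi2, integral_smul_measure, integral_smul_measure, hμc, hνc,
      ENNReal.toReal_ofReal ha, ENNReal.toReal_ofReal hb, ← add_smul, hab, one_smul]
  · have h : (ENNReal.ofReal a • (μ : Measure (LiftedParam A s X.Q)) +
        ENNReal.ofReal b • (ν : Measure (LiftedParam A s X.Q))).real
          (liftedVec ⁻¹' X.confidenceSet i) =
        a • (μ : Measure (LiftedParam A s X.Q)).real (liftedVec ⁻¹' X.confidenceSet i) +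
        b • (ν : Measure (LiftedParam A s X.Q)).real (liftedVec ⁻¹' X.confidenceSet i) := by
      simp only [Measure.real, Measure.add_apply, Measure.smul_apply, smul_eq_mul]
      rw [ENNReal.toReal_add (ENNReal.mul_ne_top ENNReal.ofReal_ne_top (measure_ne_top _ _))
        (ENNReal.mul_ne_top ENNReal.ofReal_ne_top (measure_ne_top _ _)), ENNReal.toReal_mul,
        ENNReal.toReal_mul, ENNReal.toReal_ofReal ha, ENNReal.toReal_ofReal hb]
    simp only [ProbabilityMeasure.coe_mk, h]
    exact convex_Icc _ _ (hμp i) (hνp i) ha hb hab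

lemma marginal_mixture (X : AmbiguityData A s) {μ ν : ProbabilityMeasure (Param A s)}
    (hμ : μ ∈ X.marginal) (hν : ν ∈ X.marginal) {a b : ℝ} (ha : 0 ≤ a) (hb : 0 ≤ b)
    (hab : a + b = 1) : ∃ κ ∈ X.marginal,
      (κ : Measure (Param A s)) = ENNReal.ofReal a • (μ : Measure (Param A s)) +
        ENNReal.ofReal b • (ν : Measure (Param A s)) := by
  obtain ⟨μ', hμ', hμe⟩ := hμ
  obtain ⟨ν', hν', hνe⟩ := hν
  obtain ⟨κ, hκ, hκe⟩ := X.lifted_mixture hμ' hν' ha hb hab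
  refine ⟨κ.map measurable_forget.aemeasurable, ⟨κ, hκ, rfl⟩, ?_⟩
  rw [ProbabilityMeasure.toMeasure_map, hκe, hμe, hνe, Measure.map_add _ _ measurable_forget,
    Measure.map_smul, Measure.map_smul]

/-- Rewards are uniformly bounded when the support is. -/
lemma exists_reward_bound (X : AmbiguityData A s) (hX : X.BoundedSupport) :
    ∃ R, ∀ ν ∈ X.marginal, ∀ᵐ θ ∂(ν : Measure (Param A s)), ∀ a, |θ.2 a| ≤ R := by
  obtain ⟨i, hi, hlo, -⟩ := hX
  obtain ⟨R, hR⟩ := hi.exists_norm_le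
  refine ⟨R, ?_⟩
  rintro ν ⟨μ, ⟨-, -, hp⟩, hν⟩
  have hT : MeasurableSet {θ : Param A s | ∀ a, |θ.2 a| ≤ R} := by
    simp only [Set.ofPred_forall]
    exact MeasurableSet.iInter fun a => measurableSet_le
      ((measurable_pi_apply a).comp measurable_snd).abs measurable_const
  rw [hν, ae_map_iff measurable_forget.aemeasurable hT]
  have hsub : liftedVec ⁻¹' X.confidenceSet i ⊆
      (fun θ : LiftedParam A s X.Q => ((θ.1, θ.2.1) : Param A s)) ⁻¹'
        {θ : Param A s | ∀ a, |θ.2 a| ≤ R} := fun θ hθ a =>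
    (norm_le_pi_norm θ.2.1 a).trans ((norm_fst_le (θ.2.1, θ.2.2)).trans
      ((norm_snd_le (liftedVec θ)).trans (hR _ hθ)))
  have h1 : (μ : Measure (LiftedParam A s X.Q)).real (liftedVec ⁻¹' X.confidenceSet i) = 1 :=
    le_antisymm measureReal_le_one (hlo ▸ (hp i).1)
  -- Only the larger set, defined by the reward bound, has to be measurable here.
  refine (mem_ae_iff_prob_eq_one (measurable_forget hT)).2 (le_antisymm prob_le_one ?_)
  calc (1 : ENNReal) = (μ : Measure (LiftedParam A s X.Q)) (liftedVec ⁻¹' X.confidenceSet i) := by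
        exact ((ENNReal.toReal_eq_one_iff _).1 h1).symm
    _ ≤ _ := measure_mono hsub

end AmbiguityData

end DAMDP

/-! ### Comparison of both worst cases with `v s₀`. -/

theorem theorem3 {S : Type*} [Fintype S] {A : S → Type*} [∀ s, Fintype (A s)]
    [∀ s, Nonempty (A s)] (γ : ℝ) (hγ0 : 0 ≤ γ) (hγ1 : γ < 1)
    (X : (s : S) → DAMDP.AmbiguityData A s)
    (hconic : ∀ s, (X s).ConicRepresentable)
    (hbdd : ∀ s, (X s).BoundedSupport)
    (π : DAMDP.Strategy A)
    (hπ : DAMDP.IsSRobustStrategy γ (fun s => (X s).marginal) π) (s₀ : S) :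
    DAMDP.IsDistributionallyRobust γ (DAMDP.nonstationarySet fun s => (X s).marginal) π s₀ := by
  obtain ⟨v, hv, hact⟩ := hπ
  choose R₀ hR₀ using fun s => (X s).exists_reward_bound (hbdd s)
  have hR (s : S) (ν : ProbabilityMeasure (DAMDP.Param A s)) (hν : ν ∈ (X s).marginal) :
      ∀ᵐ θ ∂(ν : Measure (DAMDP.Param A s)), ∀ a, |θ.2 a| ≤ ∑ s, |R₀ s| := by
    filter_upwards [hR₀ s ν hν] with θ hθ a
    exact (hθ a).trans ((le_abs_self _).trans (DAMDP.abs_le_sum_abs R₀ s))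
  have hupper (π' : DAMDP.Strategy A) :
      ⨅ μ ∈ DAMDP.nonstationarySet fun s => (X s).marginal, (DAMDP.w γ π' μ s₀ : EReal) ≤
        (v s₀ : EReal) := by
    by_contra! hlt
    obtain ⟨r, hr, hlt⟩ := EReal.lt_iff_exists_real_btwn.1 hlt
    have hr : v s₀ < r := EReal.coe_lt_coe_iff.1 hr
    -- A one-step excess `ε` accumulates to `ε / (1 - γ)`; this choice makes the total exactly `r -
    -- v s₀`.
    have hε : 0 < (r - v s₀) * (1 - γ) := mul_pos (sub_pos.2 hr) (sub_pos.2 hγ1)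
    -- Nonemptiness of the set of laws comes for free: an infimum over the empty set would be `⊤`,
    -- not below a real number.
    choose ν hν hνv using fun s => DAMDP.exists_law_forall_oneStep_le γ v s
      (C := (X s).marginal) (c := v s + (r - v s₀) * (1 - γ))
      (fun μ hμ ν hν a b ha hb hab => (X s).marginal_mixture hμ hν ha hb hab) (hR s)
      fun d => ((hv s).2 ⟨d, rfl⟩).trans_lt (EReal.coe_lt_coe_iff.2 (lt_add_of_pos_right _ hε))
    have h1 := DAMDP.performance_le hγ0 hγ1 v π' s₀ (fun x => ν x.1)
      (fun x => hR x.1 _ (hν x.1)) hε.le fun n g s => hνv s _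
    rw [mul_div_cancel_right₀ _ (sub_pos.2 hγ1).ne', add_sub_cancel] at h1
    refine absurd (hlt.trans_le (iInf₂_le _ ⟨fun x => ν x.1, fun x => hν x.1, rfl⟩)) ?_
    exact not_lt.2 (EReal.coe_le_coe_iff.2 h1)
  intro π'
  refine (hupper π').trans (le_iInf₂ ?_)
  rintro _ ⟨ν, hν, rfl⟩
  refine EReal.coe_le_coe_iff.2 (DAMDP.le_performance hγ0 hγ1 v π s₀ ν
    (fun x => hR x.1 _ (hν x)) fun n g s => ?_)
  -- Some `d` attains `v s`, and the action of `π` is at least as good in the worst case.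
  obtain ⟨d, hd⟩ := (hv s).1
  have h1 : (v s : EReal) ≤ DAMDP.worstCase γ v s (X s).marginal (π n g s) :=
    hd ▸ hact n g s d
  exact EReal.coe_le_coe_iff.1 (h1.trans (iInf₂_le (ν (s, n)) (hν (s, n))))
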